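/- Let $k$ be a field of characteristic $0$ (for instance $\mathbb R$ or $\mathbb C$), let $\mathfrak g$ be a finite-dimensional semisimple Lie algebra over $k$, $\mathfrak g_0\subset\mathfrak g$ a subalgebra, $V$ a finite-dimensional $\mathfrak g$-module and $V_0\subset V$ a subspace stable under $\mathfrak g_0$, i.e. let $(V,V_0)$ be a $(\mathfrak g,\mathfrak g_0)$-module. An *extension* of $(V,V_0)$ is a Lie algebra $\mathfrak h$ with a subalgebra $\mathfrak h_0$, containing $V$ as a commutative ideal with $V\cap\mathfrak h_0=V_0$, together with a surjective homomorphism of Lie algebras $\alpha\colon\mathfrak h\to\mathfrak g$ such that $\ker\alpha=V$, $\alpha(\mathfrak h_0)=\mathfrak g_0$ and $[x,v]=\alpha(x).v$ for all $x\in\mathfrak h$, $v\in V$. Two extensions $(\mathfrak h,\mathfrak h_0,\alpha)$ and $(\mathfrak h',\mathfrak h_0',\alpha')$ are *equivalent* if there is an isomorphism of Lie algebras $f\colon\mathfrak h\to\mathfrak h'$ with $f(\mathfrak h_0)=\mathfrak h_0'$, $f|_V=\mathrm{id}_V$ and $\alpha'\circ f=\alpha$. For linear maps $\varphi$ and alternating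 bilinear maps $\omega$ let $d$ be the Chevalley–Eilenberg differential, $$(d\varphi)(x,y)=x.\varphi(y)-y.\varphi(x)-\varphi([x,y]),$$ $$(d\omega)(x,y,z)=x.\omega(y,z)-y.\omega(x,z)+z.\omega(x,y)-\omega([x,y],z)+\omega([x,z],y)-\omega([y,z],x).$$ Let $H^1(\mathfrak g_0,V/V_0)$ be the first cohomology space of $\mathfrak g_0$ with values in $V/V_0$, and let $H^2(\mathfrak g,\mathfrak g_0,V,V_0)$ be the second cohomology space of the subcomplex $C^n(\mathfrak g,\mathfrak g_0,V,V_0)=\{\omega\in C^n(\mathfrak g,V)\mid\omega(\wedge^n\mathfrak g_0)\subset V_0\}$ of the standard complex $C(\mathfrak g,V)$. Then the equivalence classes of extensions of $(V,V_0)$ are in natural one-to-one correspondence with the elements of $H^1(\mathfrak g_0,V/V_0)$. More precisely, there is exactly one bijection $\Phi$ from the set of equivalence classes of extensions of $(V,V_0)$ onto $H^1(\mathfrak g_0,V/V_0)$ with the following property. Let $(\mathfrak h,\mathfrak h_0,\alpha)$ be any extension, $\beta\colon\mathfrak g\to\mathfrak h$ any linear section of $\alpha$ with $\beta(\mathfrak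 g_0)\subset\mathfrak h_0$, with its cocycle $\omega_\beta(x,y)=[\beta(x),\beta(y)]-\beta([x,y])$ in $Z^2(\mathfrak g,\mathfrak g_0,V,V_0)$, and let $\varphi\colon\mathfrak g\to V$ be any linear map such that $\pi(\varphi)\colon\mathfrak g_0\to V/V_0$, $x\mapsto\varphi(x)+V_0$, is a one-cocycle. Then $\Phi$ maps the class of $(\mathfrak h,\mathfrak h_0,\alpha)$ to the class of $\pi(\varphi)$ in $H^1(\mathfrak g_0,V/V_0)$ if and only if $\omega_\beta$ and $d\varphi$ have the same class in $H^2(\mathfrak g,\mathfrak g_0,V,V_0)$. (That is, the class of an extension in $H^2(\mathfrak g,\mathfrak g_0,V,V_0)$ is the image of $\Phi$ of the extension under the connecting map $[\pi(\varphi)]\mapsto[d\varphi]$.) -/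

import Mathlib

open LieModule.Cohomology

namespace LiePair

universe uk ug uV

section Cohomology

variable (k : Type*) [CommRing k] (L : Type*) [LieRing L] [LieAlgebra k L]
variable (M : Type*) [AddCommGroup M] [Module k M] [LieRingModule L M] [LieModule k L M]

/-- The differential `C⁰(L, M) = M → C¹(L, M)`, `(dm)(x) = x.m`. -/
def d₀₁ : M →ₗ[k] oneCochain k L M where
  toFun m :=
    { toFun := fun x => ⁅x, m⁆
      map_add' := by simp
      map_smul' := by simp }
  map_add' _ _ := by ext; simp
  map_smul' _ _ := by ext; simp

/-- One-cocycles `Z¹(L, M)`: the kernel of `d : C¹(L, M) → C²(L, M)`. -/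
def oneCocycle : Submodule k (oneCochain k L M) := LinearMap.ker (d₁₂ k L M)

/-- One-coboundaries `B¹(L, M)`, as a submodule of `Z¹(L, M)`. -/
def oneCoboundary : Submodule k (oneCocycle k L M) :=
  (LinearMap.range (d₀₁ k L M)).comap (oneCocycle k L M).subtype

/-- The first cohomology space `H¹(L, M) = Z¹(L, M) / B¹(L, M)`. -/
abbrev H1 : Type _ := oneCocycle k L M ⧸ oneCoboundary k L M

/-- Every one-coboundary is a one-cocycle. -/
theorem range_d₀₁_le : LinearMap.range (d₀₁ k L M) ≤ oneCocycle k L M := by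
  rintro _ ⟨m, rfl⟩
  simp only [oneCocycle, LinearMap.mem_ker]
  ext x y
  simp [d₀₁]

end Cohomology

/-- The additive group structure of the space of two-cochains (an abbreviation for instance
search; it is the one of a submodule). -/
instance twoCochainAddCommGroup (k : Type*) [CommRing k] (L : Type*) [LieRing L] [LieAlgebra k L]
    (M : Type*) [AddCommGroup M] [Module k M] : AddCommGroup (twoCochain k L M) :=
  Submodule.addCommGroup _

section Pair

variable {k : Type uk} [CommRing k] {g : Type ug} [LieRing g] [LieAlgebra k g]
variable {V : Type uV} [AddCommGroup V] [Module k V] [LieRingModule g V] [LieModule k g V]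
variable (g₀ : LieSubalgebra k g) (V₀ : LieSubmodule k g₀ V)

/-- The relative one-cochains `C¹(g, g₀, V, V₀)`: linear maps `φ : g → V` with `φ(g₀) ⊆ V₀`. -/
def relOneCochain : Submodule k (oneCochain k g V) where
  carrier := {φ | ∀ x ∈ g₀, φ x ∈ V₀}
  add_mem' ha hb x hx := add_mem (ha x hx) (hb x hx)
  zero_mem' _ _ := zero_mem V₀
  smul_mem' t _ ha x hx := V₀.smul_mem t (ha x hx)

/-- The relative two-cochains `C²(g, g₀, V, V₀)`: alternating bilinear maps `ω : g × g → V` with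
`ω(g₀, g₀) ⊆ V₀`. -/
def relTwoCochain : Submodule k (twoCochain k g V) where
  carrier := {ω | ∀ x ∈ g₀, ∀ y ∈ g₀, ω x y ∈ V₀}
  add_mem' ha hb x hx y hy := add_mem (ha x hx y hy) (hb x hx y hy)
  zero_mem' _ _ _ _ := zero_mem V₀
  smul_mem' t _ ha x hx y hy := V₀.smul_mem t (ha x hx y hy)

/-- The relative two-cocycles `Z²(g, g₀, V, V₀)`. -/
def relTwoCocycle : Submodule k (twoCochain k g V) := relTwoCochain g₀ V₀ ⊓ twoCocycle k g V

/-- The relative two-coboundaries `d C¹(g, g₀, V, V₀)`, as a submodule of `Z²(g, g₀, V, V₀)`. -/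
def relTwoCoboundary : Submodule k (relTwoCocycle g₀ V₀) :=
  ((relOneCochain g₀ V₀).map (d₁₂ k g V)).comap (relTwoCocycle g₀ V₀).subtype

/-- The second cohomology space `H²(g, g₀, V, V₀)` of the pair `(g, g₀)` with values in
`(V, V₀)`. -/
abbrev relH2 : Type _ := relTwoCocycle g₀ V₀ ⧸ relTwoCoboundary g₀ V₀

/-- Every relative two-coboundary is a relative two-cocycle. -/
theorem map_relOneCochain_le : (relOneCochain g₀ V₀).map (d₁₂ k g V) ≤ relTwoCocycle g₀ V₀ := by
  rintro _ ⟨φ, hφ, rfl⟩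
  refine ⟨fun x hx y hy => ?_, ?_⟩
  · have h1 : ⁅x, φ y⁆ ∈ V₀ := V₀.lie_mem (x := (⟨x, hx⟩ : g₀)) (hφ y hy)
    have h2 : ⁅y, φ x⁆ ∈ V₀ := V₀.lie_mem (x := (⟨y, hy⟩ : g₀)) (hφ x hx)
    exact sub_mem (sub_mem h1 h2) (hφ _ (g₀.lie_mem hx hy))
  · exact LinearMap.congr_fun (d₂₃_comp_d₁₂ k g V) φ

/-- The projection `π : C¹(g, V) → C¹(g₀, V/V₀)`, `π(φ)(x) = φ(x) + V₀`. -/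
def proj₁ : oneCochain k g V →ₗ[k] oneCochain k g₀ (V ⧸ V₀) where
  toFun φ := (LieSubmodule.Quotient.mk' V₀ : V →ₗ[k] V ⧸ V₀) ∘ₗ φ ∘ₗ g₀.toSubmodule.subtype
  map_add' _ _ := by ext; simp
  map_smul' _ _ := by ext; simp

/-- If `φ ∈ C¹(g, V)` and `π(φ)` is a cocycle, then `dφ` is a relative cocycle. -/
theorem d₁₂_mem_relTwoCocycle (φ : oneCochain k g V)
    (hφ : proj₁ g₀ V₀ φ ∈ oneCocycle k g₀ (V ⧸ V₀)) : d₁₂ k g V φ ∈ relTwoCocycle g₀ V₀ := by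
  refine ⟨fun x hx y hy => ?_, LinearMap.congr_fun (d₂₃_comp_d₁₂ k g V) φ⟩
  have h : d₁₂ k g₀ (V ⧸ V₀) (proj₁ g₀ V₀ φ) ⟨x, hx⟩ ⟨y, hy⟩ = 0 := by
    rw [LinearMap.mem_ker.mp hφ]; rfl
  rw [← LieSubmodule.Quotient.mk_eq_zero]
  exact h

/-- An extension of the `(g, g₀)`-module `(V, V₀)`: a pair of Lie algebras `(h, h₀)` containing `V`
(through the injection `incl`) as a commutative ideal with `V ∩ h₀ = V₀`, with a surjective
homomorphism `proj : h → g` such that `ker proj = V`, `proj(h₀) = g₀` and `[x, v] = proj(x).v`. -/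
structure Extension where
  /-- The Lie algebra `h`. -/
  carrier : Type (max ug uV)
  [lieRing : LieRing carrier]
  [lieAlgebra : LieAlgebra k carrier]
  /-- The subalgebra `h₀`. -/
  sub : LieSubalgebra k carrier
  /-- The inclusion of `V` in `h`. -/
  incl : V →ₗ[k] carrier
  /-- The homomorphism `h → g`. -/
  proj : carrier →ₗ⁅k⁆ g
  incl_injective : Function.Injective incl
  lie_incl_incl : ∀ v w : V, ⁅incl v, incl w⁆ = 0
  incl_mem_sub_iff : ∀ v : V, incl v ∈ sub ↔ v ∈ V₀
  proj_surjective : Function.Surjective proj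
  proj_eq_zero_iff : ∀ x : carrier, proj x = 0 ↔ x ∈ LinearMap.range incl
  map_proj_sub : sub.map proj = g₀
  lie_incl : ∀ (x : carrier) (v : V), ⁅x, incl v⁆ = incl ⁅proj x, v⁆

namespace Extension

attribute [instance] Extension.lieRing Extension.lieAlgebra

variable {g₀ V₀}

/-- Two extensions `(h, h₀)` and `(h', h₀')` are equivalent if there is an isomorphism of Lie
algebras `h → h'` which maps `h₀` onto `h₀'`, is the identity on `V` and induces the identity
on `g`. -/
def Equivalent (E F : Extension g₀ V₀) : Prop :=
  ∃ f : E.carrier ≃ₗ⁅k⁆ F.carrier,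
    (∀ x, f x ∈ F.sub ↔ x ∈ E.sub) ∧ (∀ v, f (E.incl v) = F.incl v) ∧
      ∀ x, F.proj (f x) = E.proj x

/-- A linear section `β` of `h → g` with `β(g₀) ⊆ h₀`. -/
structure AdaptedSection (E : Extension g₀ V₀) where
  /-- The linear map `g → h`. -/
  toLin : g →ₗ[k] E.carrier
  proj_apply : ∀ x, E.proj (toLin x) = x
  mem_sub : ∀ x ∈ g₀, toLin x ∈ E.sub

/-- The identification of `V` with its image in `h`. -/
noncomputable def inclEquiv (E : Extension g₀ V₀) : V ≃ₗ[k] LinearMap.range E.incl :=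
  LinearEquiv.ofInjective E.incl E.incl_injective

theorem incl_inclEquiv_symm (E : Extension g₀ V₀) (x : LinearMap.range E.incl) :
    E.incl (E.inclEquiv.symm x) = x := by
  have h := congrArg Subtype.val (E.inclEquiv.apply_symm_apply x)
  exact h

namespace AdaptedSection

variable {E : Extension g₀ V₀} (β : E.AdaptedSection)

theorem defect_mem (x y : g) :
    ⁅β.toLin x, β.toLin y⁆ - β.toLin ⁅x, y⁆ ∈ LinearMap.range E.incl := by
  rw [← E.proj_eq_zero_iff]
  simp [β.proj_apply]

/-- The bilinear map `ω(x, y) = [β(x), β(y)] - β([x, y])` with values in `V`. -/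
noncomputable def defect : g →ₗ[k] g →ₗ[k] V :=
  LinearMap.mk₂ k
    (fun x y => E.inclEquiv.symm ⟨⁅β.toLin x, β.toLin y⁆ - β.toLin ⁅x, y⁆, β.defect_mem x y⟩)
    (fun x x' y => E.incl_injective (by
      simp only [map_add, incl_inclEquiv_symm, add_lie]; abel))
    (fun t x y => E.incl_injective (by
      simp only [map_smul, incl_inclEquiv_symm, smul_lie, smul_sub]))
    (fun x y y' => E.incl_injective (by
      simp only [map_add, incl_inclEquiv_symm, lie_add]; abel))
    (fun t x y => E.incl_injective (by
      simp only [map_smul, incl_inclEquiv_symm, lie_smul, smul_sub]))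

theorem incl_defect (x y : g) :
    E.incl (β.defect x y) = ⁅β.toLin x, β.toLin y⁆ - β.toLin ⁅x, y⁆ := by
  simp [defect, incl_inclEquiv_symm]

/-- The two-cochain `ω(x, y) = [β(x), β(y)] - β([x, y])` in `C²(g, V)`. -/
noncomputable def cochain : twoCochain k g V :=
  ⟨β.defect, fun x => E.incl_injective (by simp [incl_defect])⟩

theorem incl_cochain (x y : g) :
    E.incl (β.cochain x y) = ⁅β.toLin x, β.toLin y⁆ - β.toLin ⁅x, y⁆ := β.incl_defect x y

theorem cochain_mem : β.cochain ∈ relTwoCocycle g₀ V₀ := by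
  refine ⟨fun x hx y hy => ?_, ?_⟩
  · rw [← E.incl_mem_sub_iff, incl_cochain]
    exact sub_mem (E.sub.lie_mem (β.mem_sub x hx) (β.mem_sub y hy))
      (β.mem_sub _ (g₀.lie_mem hx hy))
  · change β.cochain ∈ twoCocycle k g V
    rw [mem_twoCocycle_iff]
    have key : ∀ x (v : V), E.incl ⁅x, v⁆ = ⁅β.toLin x, E.incl v⁆ := fun x v => by
      rw [E.lie_incl, β.proj_apply]
    have hd : ∀ x y z, d₂₃ k g V β.cochain x y z = 0 := fun x y z => by
      apply E.incl_injective
      rw [d₂₃_apply]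
      simp only [map_add, map_sub, key, incl_cochain, map_zero, lie_sub]
      rw [← lie_skew (β.toLin z) ⁅β.toLin x, β.toLin y⁆, lie_lie, lie_lie x y z,
        ← lie_skew (β.toLin ⁅x, y⁆) (β.toLin z), ← lie_skew (β.toLin ⁅x, z⁆) (β.toLin y),
        ← lie_skew (β.toLin ⁅y, z⁆) (β.toLin x), ← lie_skew ⁅x, z⁆ y, ← lie_skew ⁅y, z⁆ x]
      simp only [map_sub, map_neg]
      abel
    ext x y z
    exact hd x y z

/-- The two-cocycle `ω(x, y) = [β(x), β(y)] - β([x, y])` in `Z²(g, g₀, V, V₀)`. -/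
noncomputable def cocycle : relTwoCocycle g₀ V₀ := ⟨β.cochain, β.cochain_mem⟩

end AdaptedSection

variable (g₀ V₀)

/-- Equivalence of extensions is an equivalence relation. -/
instance setoid : Setoid (Extension g₀ V₀) where
  r := Equivalent
  iseqv :=
    { refl := fun E => ⟨LieEquiv.refl, fun _ => Iff.rfl, fun _ => rfl, fun _ => rfl⟩
      symm := by
        rintro E F ⟨f, h1, h2, h3⟩
        refine ⟨f.symm, fun x => ?_, fun v => ?_, fun x => ?_⟩
        · rw [← h1, LieEquiv.apply_symm_apply]
        · rw [← h2, LieEquiv.symm_apply_apply]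
        · rw [← h3, LieEquiv.apply_symm_apply]
      trans := by
        rintro E F G ⟨f, h1, h2, h3⟩ ⟨f', h1', h2', h3'⟩
        refine ⟨f.trans f', fun x => ?_, fun v => ?_, fun x => ?_⟩
        · simp [LieEquiv.trans_apply, h1, h1']
        · simp [LieEquiv.trans_apply, h2, h2']
        · simp [LieEquiv.trans_apply, h3, h3'] }

end Extension

/-- The equivalence classes of extensions of the `(g, g₀)`-module `(V, V₀)`. -/
abbrev ExtensionClass : Type _ := Quotient (Extension.setoid g₀ V₀)

end Pair

end LiePair

/-! The restriction `π` fits into a short exact sequence of complexes `0 → C(g, g₀, V, V₀) → C(g, V)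
→ C(g₀, V/V₀) → 0`. Whitehead's lemmas give `H¹(g, V) = H²(g, V) = 0`, so the connecting map `[π(φ)]
↦ [dφ]` from `H¹(g₀, V/V₀)` to `H²(g, g₀, V, V₀)` is bijective (`H1_mk_eq_iff_relH2_mk_eq`,
`exists_d₁₂_eq`). On the other side, an adapted section identifies `h` with `g × V` and `h₀` with
`g₀ × V₀`, the bracket being twisted by a relative cocycle; changing the section adds a relative
coboundary, and every relative cocycle occurs. Hence extensions are classified by `H²(g, g₀, V, V₀)`
(`equivalent_iff`, `exists_cocycle_eq`), and composing the two bijections gives `Φ`.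

Whitehead's lemmas are proved by induction on `dim V`. A Casimir operator `C` is null-homotopic on
cocycles of degree one and two. On a nontrivial module some `C` is not nilpotent, so a Fitting
argument writes `1 = Q C + P` with `P` landing in a proper submodule: `Q C` is handled by the
homotopy, `P` by induction. Trivial modules are treated through `[g, g] = g`. -/

section Whitehead

open TensorProduct LieModule

variable {k : Type*} [Field k] {g : Type*} [LieRing g] [LieAlgebra k g]

/-! ### Casimir operators and their homotopies -/

namespace LieAlgebra

/-- The family `e i ⊗ f i` sums to a `g`-invariant element of `g ⊗ g`. -/
def IsInvariantPair {ι : Type*} [Fintype ι] (k : Type*) [Field k] {g : Type*} [LieRing g]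
    [LieAlgebra k g] (e f : ι → g) : Prop :=
  ∀ x : g, ∑ i, (⁅x, e i⁆ ⊗ₜ[k] f i + e i ⊗ₜ[k] ⁅x, f i⁆) = 0

/-- The Casimir operator `∑ i, e i * f i` on a module. -/
def casimir (k : Type*) [Field k] {g : Type*} [LieRing g] [LieAlgebra k g]
    {ι : Type*} [Fintype ι] (e f : ι → g)
    (V : Type*) [AddCommGroup V] [Module k V] [LieRingModule g V] [LieModule k g V] :
    Module.End k V :=
  ∑ i, toEnd k g V (e i) * toEnd k g V (f i)

theorem casimir_apply {ι : Type*} [Fintype ι] (e f : ι → g) {V : Type*} [AddCommGroup V]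
    [Module k V] [LieRingModule g V] [LieModule k g V] (v : V) :
    casimir k e f V v = ∑ i, ⁅e i, ⁅f i, v⁆⁆ := by
  simp [casimir]

namespace IsInvariantPair

variable {ι : Type*} [Fintype ι] {e f : ι → g}

/-- A bilinear map factors through `g ⊗ g`, so it can be applied to the invariance relation. This is
how invariance enters all the computations with `C`. -/
theorem sum_bilin (h : IsInvariantPair k e f) {W : Type*} [AddCommGroup W] [Module k W]
    (F : g →ₗ[k] g →ₗ[k] W) (x : g) : ∑ i, F ⁅x, e i⁆ (f i) = -∑ i, F (e i) ⁅x, f i⁆ := by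
  rw [← add_eq_zero_iff_eq_neg, ← Finset.sum_add_distrib]
  simpa using congrArg (TensorProduct.lift F) (h x)

variable {V : Type*} [AddCommGroup V] [Module k V] [LieRingModule g V] [LieModule k g V]

theorem sum_lie_apply (h : IsInvariantPair k e f) (φ : g →ₗ[k] V) (x : g) :
    ∑ i, ⁅⁅x, e i⁆, φ (f i)⁆ = -∑ i, ⁅e i, φ ⁅x, f i⁆⁆ := by
  have := h.sum_bilin ((toEnd k g V : g →ₗ[k] Module.End k V).compl₂ φ) x
  simpa using this

theorem lie_casimir (h : IsInvariantPair k e f) (x : g) (v : V) :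
    ⁅x, casimir k e f V v⁆ = casimir k e f V ⁅x, v⁆ := by
  have := h.sum_lie_apply ((toEnd k g V : g →ₗ[k] Module.End k V).flip v) x
  simp only [LinearMap.flip_apply, LieHom.coe_toLinearMap, toEnd_apply_apply] at this
  simp only [casimir_apply, lie_sum]
  simp only [leibniz_lie x (e _), leibniz_lie x (f _), lie_add, Finset.sum_add_distrib, this]
  abel

/-- The Casimir operator maps a one-cocycle to a coboundary. -/
theorem casimir_oneCocycle (h : IsInvariantPair k e f) (φ : oneCochain k g V)
    (hφ : d₁₂ k g V φ = 0) (x : g) :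
    casimir k e f V (φ x) = ⁅x, ∑ i, ⁅e i, φ (f i)⁆⁆ := by
  have hc (x y : g) : φ ⁅x, y⁆ = ⁅x, φ y⁆ - ⁅y, φ x⁆ := by
    have := d₁₂_apply_apply k g V φ x y
    rw [hφ] at this
    exact (sub_eq_zero.mp this.symm).symm
  -- Invariance moves `x` from `e i` to `f i`; expanding `φ ⁅x, f i⁆` by the cocycle identity then
  -- leaves only the Casimir term.
  have h1 := h.sum_lie_apply φ x
  simp only [hc, lie_sub, Finset.sum_sub_distrib] at h1
  simp only [casimir_apply, lie_sum]
  simp only [leibniz_lie x (e _), Finset.sum_add_distrib, h1]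
  abel

/-- The Casimir operator maps a two-cocycle to a coboundary. -/
theorem casimir_twoCocycle (h : IsInvariantPair k e f) (ω : twoCochain k g V)
    (hω : d₂₃ k g V ω = 0) :
    ∃ ψ : oneCochain k g V, ∀ x y, d₁₂ k g V ψ x y = casimir k e f V (ω x y) := by
  -- The contracting homotopy in degree two: `ψ(y) = ∑ eᵢ.ω(fᵢ, y)`.
  refine ⟨∑ i, (toEnd k g V (e i)) ∘ₗ ω (f i), fun x y => ?_⟩
  -- The cocycle identity solved for `z.ω(x, y)`, to be used with `z = f i`.
  have hc (x y z : g) : ⁅z, ω x y⁆ = ω ⁅x, y⁆ z - ω ⁅x, z⁆ y + ω ⁅y, z⁆ x - ⁅x, ω y z⁆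
      + ⁅y, ω x z⁆ := by
    have := d₂₃_apply k g V ω x y z
    rw [hω] at this
    simp only [LinearMap.zero_apply] at this
    rw [← sub_eq_zero, this]
    abel
  have h1 (x y : g) : ∑ i, ⁅⁅x, e i⁆, ω (f i) y⁆ = -∑ i, ⁅e i, ω ⁅x, f i⁆ y⁆ :=
    h.sum_lie_apply (ω.1.flip y) x
  simp only [d₁₂_apply_apply, LinearMap.sum_apply, LinearMap.comp_apply, toEnd_apply_apply,
    lie_sum, casimir_apply]
  simp only [leibniz_lie x (e _), leibniz_lie y (e _), Finset.sum_add_distrib, h1]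
  simp only [hc x y, ← Finset.sum_add_distrib, ← Finset.sum_sub_distrib, ← Finset.sum_neg_distrib]
  refine Finset.sum_congr rfl fun i _ => ?_
  rw [← twoCochain_skew ω ⁅x, y⁆ (f i), ← twoCochain_skew ω y (f i), ← twoCochain_skew ω x (f i)]
  simp only [lie_add, lie_sub, lie_neg]
  abel

end IsInvariantPair

theorem d₁₂_comp {V : Type*} [AddCommGroup V] [Module k V] [LieRingModule g V] [LieModule k g V]
    {W : Type*} [AddCommGroup W] [Module k W] [LieRingModule g W] [LieModule k g W]
    (P : V →ₗ⁅k,g⁆ W) (φ : oneCochain k g V) (x y : g) :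
    d₁₂ k g W ((P : V →ₗ[k] W) ∘ₗ φ) x y = P (d₁₂ k g V φ x y) := by
  simp

/-! ### Whitehead's lemmas -/

section Semisimple

variable [CharZero k] [FiniteDimensional k g] [IsSemisimple k g]

/-- By invariance of the Killing form, the orthogonal complement of `[g, g]` is central, hence zero.
-/
theorem IsSemisimple.lie_top_eq_top : ⁅(⊤ : LieIdeal k g), (⊤ : LieIdeal k g)⁆ = ⊤ := by
  set I : LieIdeal k g := ⁅(⊤ : LieIdeal k g), (⊤ : LieIdeal k g)⁆
  have hI : I.killingCompl = ⊥ := by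
    have hc : LieIdeal.killingCompl k g I ≤ LieAlgebra.center k g := by
      intro x hx
      rw [LieModule.mem_maxTrivSubmodule]
      intro y
      refine (IsKilling.killingForm_nondegenerate k g).1 _ fun z => ?_
      rw [← lie_skew, map_neg, LinearMap.neg_apply, killingForm, traceForm_apply_lie_apply,
        neg_eq_zero, traceForm_comm]
      exact (LieIdeal.mem_killingCompl k g I).mp hx _
        (LieSubmodule.lie_mem_lie (LieSubmodule.mem_top y) (LieSubmodule.mem_top z))
    rw [LieAlgebra.center_eq_bot] at hc
    exact le_bot_iff.mp hc
  have := (LieIdeal.isCompl_killingCompl I).sup_eq_top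
  rwa [hI, sup_bot_eq] at this

variable {V : Type*} [AddCommGroup V] [Module k V] [LieRingModule g V] [LieModule k g V]
  [FiniteDimensional k V]

/-- A finite-dimensional module of a semisimple Lie algebra with zero trace form is trivial. -/
theorem IsSemisimple.isTrivial_of_traceForm_eq_zero (h : traceForm k g V = 0) :
    LieModule.IsTrivial g V := by
  have hn := isNilpotent_derivedSeries_of_traceForm_eq_zero h
  -- By Engel's theorem nilpotency can be tested on single elements, and each element of `g` lies in
  -- the derived ideal.
  have hg : LieModule.IsNilpotent g V := by
    rw [LieModule.isNilpotent_iff_forall' (R := k)] at hn ⊢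
    intro x
    have hx : x ∈ derivedSeries k g 1 := by
      rw [derivedSeries_def, derivedSeriesOfIdeal_succ, derivedSeriesOfIdeal_zero,
        IsSemisimple.lie_top_eq_top]
      exact LieSubmodule.mem_top x
    exact hn ⟨x, hx⟩
  -- Since `g = [g, g]`, the lower central series of `V` is constant from index one on; nilpotency
  -- then forces `[g, V] = 0`.
  have hle : ⁅(⊤ : LieIdeal k g), (⊤ : LieSubmodule k g V)⁆ ≤
      ⁅(⊤ : LieIdeal k g), ⁅(⊤ : LieIdeal k g), (⊤ : LieSubmodule k g V)⁆⁆ := by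
    nth_rewrite 1 [← IsSemisimple.lie_top_eq_top (k := k) (g := g)]
    rw [LieSubmodule.lie_le_iff]
    intro x hx m hm
    rw [← LieSubmodule.mem_toSubmodule, LieSubmodule.lieIdeal_oper_eq_linear_span'] at hx
    induction hx using Submodule.span_induction with
    | mem x hx =>
      obtain ⟨a, ha, b, hb, rfl⟩ := hx
      rw [lie_lie]
      exact sub_mem (LieSubmodule.lie_mem_lie ha (LieSubmodule.lie_mem_lie hb hm))
        (LieSubmodule.lie_mem_lie hb (LieSubmodule.lie_mem_lie ha hm))
    | zero => simp
    | add x y _ _ hx hy => rw [add_lie]; exact add_mem hx hy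
    | smul t x _ hx => rw [smul_lie]; exact SMulMemClass.smul_mem t hx
  have hlcs (n : ℕ) : lowerCentralSeries k g V 1 ≤ lowerCentralSeries k g V (n + 1) := by
    induction n with
    | zero => exact le_rfl
    | succ n ih =>
      refine le_trans hle ?_
      rw [lowerCentralSeries_succ k g V (n + 1)]
      exact LieSubmodule.mono_lie le_rfl ih
  obtain ⟨n, hn⟩ := (isNilpotent_iff k g V).mp hg
  have h1 := (hlcs n).trans (antitone_lowerCentralSeries k g V n.le_succ)
  rw [hn] at h1
  rw [lowerCentralSeries_succ, lowerCentralSeries_zero] at h1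
  refine ⟨fun x m => ?_⟩
  exact (LieSubmodule.mem_bot _).mp
    (h1 (LieSubmodule.lie_mem_lie (LieSubmodule.mem_top x) (LieSubmodule.mem_top m)))

/-- On a nontrivial module of a semisimple Lie algebra some Casimir operator is not nilpotent. -/
theorem IsSemisimple.exists_not_isNilpotent_casimir (h : ¬ LieModule.IsTrivial g V) :
    ∃ (n : ℕ) (e f : Fin n → g), IsInvariantPair k e f ∧
      ¬ _root_.IsNilpotent (casimir k e f V) := by
  set B := traceForm k g V
  -- `J` is the radical of the trace form; the Casimir operator is built from dual bases of its
  -- Killing complement `I`.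
  let J : LieIdeal k g :=
    { LinearMap.ker B with
      lie_mem := by
        intro x m hm
        have hm' : B m = 0 := hm
        change B ⁅x, m⁆ = 0
        ext y
        rw [traceForm_apply_lie_apply', hm']
        simp }
  have hJ (x : g) : x ∈ J ↔ B x = 0 := Iff.rfl
  set I : LieIdeal k g := J.killingCompl
  have hIJ : IsCompl J I := LieIdeal.isCompl_killingCompl J
  let BI : LinearMap.BilinForm k I := B.restrict I.toSubmodule
  have hBI : BI.IsSymm := ⟨fun x y => traceForm_comm k g V x y⟩
  -- An element of `I` orthogonal to `I` is also orthogonal to the radical `J`, hence to `g`, so it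
  -- lies in `J ⊓ I = 0`.
  have hnd : BI.Nondegenerate := by
    refine (LinearMap.IsRefl.nondegenerate_iff_separatingLeft hBI.isRefl).mpr ?_
    intro x hx
    have hxJ : (x : g) ∈ J := by
      rw [hJ]
      ext y
      obtain ⟨a, ha, b, hb, rfl⟩ := LieSubmodule.mem_sup J I y |>.mp
        (by rw [hIJ.sup_eq_top]; exact LieSubmodule.mem_top y)
      have h1 : B x a = 0 := by
        rw [traceForm_comm, (hJ a).mp ha]; rfl
      have h2 : B x b = 0 := hx ⟨b, hb⟩
      simp [h1, h2]
    have : (x : g) ∈ J ⊓ I := ⟨hxJ, x.2⟩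
    rw [hIJ.inf_eq_bot, LieSubmodule.mem_bot] at this
    exact Subtype.ext this
  let b := Module.finBasis k I
  let b' := BI.dualBasis hnd b
  have hb (y : I) : y = ∑ j, BI y (b' j) • b j := by
    conv_lhs => rw [← b.sum_repr y]
    refine Finset.sum_congr rfl fun j _ => ?_
    congr 1
    have := LinearMap.BilinForm.dualBasis_repr_apply hnd b' y j
    rwa [LinearMap.BilinForm.dualBasis_dualBasis hnd hBI] at this
  have hb' (y : I) : y = ∑ j, BI y (b j) • b' j := by
    conv_lhs => rw [← b'.sum_repr y]
    simp only [b', LinearMap.BilinForm.dualBasis_repr_apply]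
  refine ⟨_, fun i => b i, fun i => b' i, fun x => ?_, fun hnil => ?_⟩
  · have h1 (i) : ⁅x, (b i : g)⁆ = ∑ j, B ⁅x, (b i : g)⁆ (b' j) • (b j : g) := by
      refine (congrArg Subtype.val (hb ⁅x, b i⁆)).trans ?_
      rw [AddSubmonoidClass.coe_finsetSum]
      rfl
    have h2 (i) : ⁅x, (b' i : g)⁆ = ∑ j, B ⁅x, (b' i : g)⁆ (b j) • (b' j : g) := by
      refine (congrArg Subtype.val (hb' ⁅x, b' i⁆)).trans ?_
      rw [AddSubmonoidClass.coe_finsetSum]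
      rfl
    have h3 : ∑ i, ⁅x, (b i : g)⁆ ⊗ₜ[k] (b' i : g) =
        ∑ i, ∑ j, B ⁅x, (b i : g)⁆ (b' j) • ((b j : g) ⊗ₜ[k] (b' i : g)) :=
      Finset.sum_congr rfl fun i _ => by
        conv_lhs => rw [h1, TensorProduct.sum_tmul]
        rfl
    have h4 : ∑ i, (b i : g) ⊗ₜ[k] ⁅x, (b' i : g)⁆ =
        ∑ i, ∑ j, B ⁅x, (b' i : g)⁆ (b j) • ((b i : g) ⊗ₜ[k] (b' j : g)) :=
      Finset.sum_congr rfl fun i _ => by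
        conv_lhs => rw [h2, TensorProduct.tmul_sum]
        simp only [TensorProduct.tmul_smul]
    rw [Finset.sum_add_distrib, h3, h4]
    -- After exchanging the indices in the second sum, the coefficients cancel in pairs by
    -- invariance of the trace form.
    nth_rewrite 2 [Finset.sum_comm]
    rw [← Finset.sum_add_distrib]
    refine Finset.sum_eq_zero fun i _ => ?_
    rw [← Finset.sum_add_distrib]
    refine Finset.sum_eq_zero fun j _ => ?_
    rw [← add_smul, traceForm_apply_lie_apply', traceForm_comm k g V ⁅x, (b' j : g)⁆,
      neg_add_cancel, zero_smul]
  -- Each summand has trace `B(bᵢ, b'ᵢ) = 1`. A nilpotent `C` has trace zero, so in characteristic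
  -- zero `I = 0`, the trace form vanishes and the module is trivial.
  · have htr : LinearMap.trace k V (casimir k (fun i => (b i : g)) (fun i => (b' i : g)) V) =
        Module.finrank k I := by
      have (i : Fin (Module.finrank k I)) :
          LinearMap.trace k V (toEnd k g V (b i) * toEnd k g V (b' i)) = 1 := by
        have := LinearMap.BilinForm.apply_dualBasis_right hnd hBI b i i
        rw [if_pos rfl] at this
        exact this
      simp [casimir, map_sum, this]
    have h0 := (LinearMap.isNilpotent_trace_of_isNilpotent hnil).eq_zero
    rw [htr, Nat.cast_eq_zero, Module.finrank_zero_iff] at h0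
    have hI : I = ⊥ := by
      rw [eq_bot_iff]
      intro x hx
      rw [LieSubmodule.mem_bot]
      exact congrArg Subtype.val (Subsingleton.elim (⟨x, hx⟩ : I) 0)
    have hJt := hIJ.sup_eq_top
    rw [hI, sup_bot_eq] at hJt
    refine h (IsSemisimple.isTrivial_of_traceForm_eq_zero (k := k) ?_)
    ext x y
    have : x ∈ J := hJt ▸ LieSubmodule.mem_top x
    exact LinearMap.congr_fun ((hJ x).mp this) y

/-- For a nontrivial module there are an invariant pair with Casimir operator `C`, an
endomorphism `Q` and a homomorphism `P` to a proper submodule `W` such that `1 = Q C + P`. -/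
theorem IsSemisimple.exists_casimir_quasi_inverse (h : ¬ LieModule.IsTrivial g V) :
    ∃ (n : ℕ) (e f : Fin n → g) (Q : V →ₗ⁅k,g⁆ V) (W : LieSubmodule k g V)
      (P : V →ₗ⁅k,g⁆ W), IsInvariantPair k e f ∧
      (∀ v, v = Q (casimir k e f V v) + P v) ∧ Module.finrank k W < Module.finrank k V := by
  obtain ⟨n, e, f, hinv, hnil⟩ := IsSemisimple.exists_not_isNilpotent_casimir (k := k) h
  set C := casimir k e f V
  have hcomm (p : Polynomial k) (x : g) (v : V) :
      ⁅x, Polynomial.aeval C p v⁆ = Polynomial.aeval C p ⁅x, v⁆ := by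
    have h1 : Commute C (toEnd k g V x) := by
      ext v
      exact (hinv.lie_casimir x v).symm
    have h2 : Commute (Polynomial.aeval C p) (toEnd k g V x) := by
      induction p using Polynomial.induction_on' with
      | add p q hp hq => rw [map_add]; exact hp.add_left hq
      | monomial n a =>
        rw [Polynomial.aeval_monomial]
        exact Commute.mul_left (Algebra.commutes a (toEnd k g V x)) (h1.pow_left n)
    exact (LinearMap.congr_fun h2.eq v).symm
  have hm : minpoly k C ≠ 0 := minpoly.ne_zero (Algebra.IsIntegral.isIntegral C)
  -- Fitting decomposition: the minimal polynomial is `X ^ m * r` with `r(0) = c ≠ 0`, so `r(C)`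
  -- maps into `ker (C ^ m)`.
  obtain ⟨r, hr, hdvd⟩ := Polynomial.exists_eq_pow_rootMultiplicity_mul_and_not_dvd _ hm 0
  set m := Polynomial.rootMultiplicity 0 (minpoly k C)
  rw [Polynomial.C_0, sub_zero] at hr hdvd
  set c := r.coeff 0
  have hc : c ≠ 0 := fun hc => hdvd (Polynomial.X_dvd_iff.mpr hc)
  have hCr (v : V) : (C ^ m) (Polynomial.aeval C r v) = 0 := by
    have h1 := minpoly.aeval k C
    rw [hr] at h1
    simpa using LinearMap.congr_fun h1 v
  let W : LieSubmodule k g V :=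
    { LinearMap.ker (C ^ m) with
      lie_mem := by
        intro x v hv
        have hv' : (C ^ m) v = 0 := hv
        change (C ^ m) ⁅x, v⁆ = 0
        have := hcomm (Polynomial.X ^ m) x v
        rw [map_pow, Polynomial.aeval_X] at this
        rw [← this, hv', lie_zero] }
  -- From `r = r.divX * X + c` one gets `1 - q(C) C = c⁻¹ r(C)`, which takes values in `W`.
  set q := Polynomial.C (-c⁻¹) * r.divX
  have hW (v : V) : v - Polynomial.aeval C q (C v) ∈ W := by
    have h1 : v - Polynomial.aeval C q (C v) = c⁻¹ • Polynomial.aeval C r v := by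
      have h2 : Polynomial.aeval C r v = Polynomial.aeval C r.divX (C v) + c • v := by
        conv_lhs => rw [← Polynomial.divX_mul_X_add r]
        simp [c]
      rw [h2]
      simp [q, smul_smul, hc]
      abel
    change (C ^ m) _ = 0
    rw [h1, map_smul, hCr, smul_zero]
  let P : V →ₗ[k] W := (LinearMap.id - Polynomial.aeval C q ∘ₗ C).codRestrict W.toSubmodule hW
  have hP (x : g) (v : V) : P ⁅x, v⁆ = ⁅x, P v⁆ := by
    refine Subtype.ext ?_
    change ⁅x, v⁆ - Polynomial.aeval C q (C ⁅x, v⁆) = ⁅x, v - Polynomial.aeval C q (C v)⁆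
    rw [lie_sub, hcomm, hinv.lie_casimir]
  refine ⟨n, e, f, { Polynomial.aeval C q with map_lie' := (hcomm q _ _).symm }, W,
    { P with map_lie' := hP _ _ }, hinv, fun v => ?_, ?_⟩
  · exact (add_sub_cancel _ v).symm
  · refine Submodule.finrank_lt (s := LinearMap.ker (C ^ m)) fun htop => hnil ⟨m, ?_⟩
    exact LinearMap.ker_eq_top.mp htop

/-- **Whitehead's first lemma**. -/
theorem IsSemisimple.oneCocycle_eq_lie (φ : oneCochain k g V) (hφ : d₁₂ k g V φ = 0) :
    ∃ v : V, ∀ x, φ x = ⁅x, v⁆ := by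
  induction hn : Module.finrank k V using Nat.strong_induction_on generalizing V with
  | _ n ih =>
  by_cases htriv : LieModule.IsTrivial g V
  · refine ⟨0, fun x => ?_⟩
    have hx : x ∈ ⁅(⊤ : LieIdeal k g), (⊤ : LieIdeal k g)⁆ := by
      rw [IsSemisimple.lie_top_eq_top]
      exact LieSubmodule.mem_top x
    rw [← LieSubmodule.mem_toSubmodule, LieSubmodule.lieIdeal_oper_eq_linear_span'] at hx
    rw [lie_zero]
    -- On a trivial module a cocycle kills all brackets, and these span `g`.
    refine (Submodule.span_le (p := LinearMap.ker φ)).mpr ?_ hx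
    rintro _ ⟨a, -, b, -, rfl⟩
    have := d₁₂_apply_apply_ofTrivial k g V φ a b
    rw [hφ] at this
    exact neg_eq_zero.mp this.symm
  · obtain ⟨m, e, f, Q, W, P, hinv, hQP, hlt⟩ :=
      IsSemisimple.exists_casimir_quasi_inverse (k := k) htriv
    obtain ⟨w, hw⟩ := ih _ (hn ▸ hlt) ((P : V →ₗ[k] W) ∘ₗ φ) (by
      ext x y : 3
      refine (d₁₂_comp P φ x y).trans ?_
      rw [hφ]
      exact map_zero P) rfl
    refine ⟨Q (∑ i, ⁅e i, φ (f i)⁆) + w, fun x => ?_⟩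
    have hw' : P (φ x) = ⁅x, w⁆ := hw x
    rw [hQP (φ x), hinv.casimir_oneCocycle φ hφ, hw', lie_add, LieModuleHom.map_lie,
      LieSubmodule.coe_bracket]

/-- **Whitehead's second lemma**. -/
theorem IsSemisimple.twoCocycle_eq_d₁₂ (ω : twoCochain k g V) (hω : d₂₃ k g V ω = 0) :
    ∃ ψ : oneCochain k g V, d₁₂ k g V ψ = ω := by
  suffices ∃ ψ : oneCochain k g V, ∀ x y, d₁₂ k g V ψ x y = ω x y by
    obtain ⟨ψ, hψ⟩ := this
    exact ⟨ψ, Subtype.ext (LinearMap.ext₂ hψ)⟩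
  induction hn : Module.finrank k V using Nat.strong_induction_on generalizing V with
  | _ n ih =>
  by_cases htriv : LieModule.IsTrivial g V
  · have hc := (mem_twoCocycle_iff_of_trivial k g V ω).mp ((mem_twoCocycle_iff k g V ω).mpr hω)
    -- For trivial `V`, the map `x ↦ ω(x, ·)` is a one-cocycle with values in the (not necessarily
    -- trivial) module `Hom(g, V)`. The first lemma gives `ω(x, ·) = x.ψ`, that is `ω(x, y) = -ψ([x,
    -- y])`.
    obtain ⟨ψ, hψ⟩ := IsSemisimple.oneCocycle_eq_lie (k := k) (g := g) (V := g →ₗ[k] V) ω.1 (by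
      ext x y z : 5
      change ⁅x, ω.1 y⁆ z - ⁅y, ω.1 x⁆ z - ω ⁅x, y⁆ z = 0
      simp only [LieHom.lie_apply, trivial_lie_zero, twoCochain_val_apply]
      rw [hc x y z]
      abel)
    refine ⟨ψ, fun x y => ?_⟩
    have := LinearMap.congr_fun (hψ x) y
    rw [LieHom.lie_apply, trivial_lie_zero, zero_sub] at this
    rw [d₁₂_apply_apply_ofTrivial]
    exact this.symm
  · obtain ⟨m, e, f, Q, W, P, hinv, hQP, hlt⟩ :=
      IsSemisimple.exists_casimir_quasi_inverse (k := k) htriv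
    let ωW : twoCochain k g W :=
      ⟨ω.1.compr₂ (P : V →ₗ[k] W), fun x => by
        change P (ω x x) = 0
        rw [twoCochain_alt, map_zero]⟩
    have hωW (x y : g) : ωW x y = P (ω x y) := rfl
    obtain ⟨ψ₀, hψ₀⟩ := ih _ (hn ▸ hlt) ωW (by
      ext x y z : 3
      rw [d₂₃_apply]
      simp only [hωW, ← LieModuleHom.map_lie, ← map_add, ← map_sub]
      rw [← d₂₃_apply k g V ω x y z, hω]
      exact map_zero P) rfl
    obtain ⟨ψ₁, hψ₁⟩ := hinv.casimir_twoCocycle ω hω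
    -- Here `dψ₁ = C ω` and `dψ₀ = P ω`, so the sum has differential `(Q C + P) ω = ω`.
    refine ⟨(Q : V →ₗ[k] V) ∘ₗ ψ₁ + (W.incl : W →ₗ[k] V) ∘ₗ ψ₀, fun x y => ?_⟩
    rw [map_add, add_apply_apply, d₁₂_comp, d₁₂_comp, hψ₁, hψ₀, hωW]
    exact (hQP _).symm

end Semisimple

end LieAlgebra

end Whitehead

namespace LiePair

universe uk ug uV

/-! ### Extensions and relative two-cocycles -/

section Extensions

variable {k : Type uk} [Field k] {g : Type ug} [LieRing g] [LieAlgebra k g]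
variable {V : Type uV} [AddCommGroup V] [Module k V] [LieRingModule g V] [LieModule k g V]
variable {g₀ : LieSubalgebra k g} {V₀ : LieSubmodule k g₀ V}

theorem proj₁_surjective : Function.Surjective (proj₁ g₀ V₀) := by
  intro c
  obtain ⟨s, hs⟩ := LinearMap.exists_rightInverse_of_surjective
    (LieSubmodule.Quotient.mk' V₀ : V →ₗ[k] V ⧸ V₀)
    (LinearMap.range_eq_top.mpr (LieSubmodule.Quotient.surjective_mk' V₀))
  -- Lift the cochain to `V` along a linear section of `V → V/V₀`, then extend it linearly from `g₀`
  -- to `g`.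
  obtain ⟨φ, hφ⟩ := LinearMap.exists_extend (p := g₀.toSubmodule) (s ∘ₗ c)
  refine ⟨φ, LinearMap.ext fun x => ?_⟩
  change LieSubmodule.Quotient.mk' V₀ (φ x) = c x
  have h1 : φ x = s (c x) := LinearMap.congr_fun hφ x
  rw [h1]
  exact LinearMap.congr_fun hs (c x)

theorem proj₁_eq_zero_iff (φ : oneCochain k g V) :
    proj₁ g₀ V₀ φ = 0 ↔ φ ∈ relOneCochain g₀ V₀ := by
  constructor
  · intro h x hx
    rw [← LieSubmodule.Quotient.mk_eq_zero]
    exact LinearMap.congr_fun h ⟨x, hx⟩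
  · intro h
    ext x
    exact (LieSubmodule.Quotient.mk_eq_zero (N := V₀)).mpr (h x x.2)

theorem proj₁_d₀₁ (v : V) :
    proj₁ g₀ V₀ (d₀₁ k g V v) = d₀₁ k g₀ (V ⧸ V₀) (LieSubmodule.Quotient.mk' V₀ v) := rfl

theorem relH2_mk_eq_iff (c c' : relTwoCocycle g₀ V₀) :
    (Submodule.Quotient.mk c : relH2 g₀ V₀) = Submodule.Quotient.mk c' ↔
      ∃ ψ ∈ relOneCochain g₀ V₀, d₁₂ k g V ψ = c.1 - c'.1 := by
  rw [Submodule.Quotient.eq]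
  rfl

theorem H1_mk_eq_iff (c c' : oneCocycle k g₀ (V ⧸ V₀)) :
    (Submodule.Quotient.mk c : H1 k g₀ (V ⧸ V₀)) = Submodule.Quotient.mk c' ↔
      ∃ m, d₀₁ k g₀ (V ⧸ V₀) m = c.1 - c'.1 := by
  rw [Submodule.Quotient.eq]
  rfl

namespace Extension

variable (E F : Extension g₀ V₀)

theorem nonempty_adaptedSection : Nonempty E.AdaptedSection := by
  obtain ⟨s, hs⟩ := (E.proj : E.carrier →ₗ[k] g).exists_rightInverse_of_surjective
    (LinearMap.range_eq_top.mpr E.proj_surjective)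
  have hmem (x : E.sub) : E.proj x ∈ g₀ := by
    exact E.map_proj_sub.le ⟨x, x.2, rfl⟩
  let p : E.sub →ₗ[k] g₀ :=
    ((E.proj : E.carrier →ₗ[k] g) ∘ₗ E.sub.toSubmodule.subtype).codRestrict g₀.toSubmodule hmem
  have hp : Function.Surjective p := by
    rintro ⟨x, hx⟩
    obtain ⟨y, hy, rfl⟩ := E.map_proj_sub.ge hx
    exact ⟨⟨y, hy⟩, rfl⟩
  obtain ⟨s₀, hs₀⟩ := p.exists_rightInverse_of_surjective (LinearMap.range_eq_top.mpr hp)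
  obtain ⟨r, hr⟩ := g₀.toSubmodule.subtype.exists_leftInverse_of_injective
    (LinearMap.ker_eq_bot.mpr Subtype.val_injective)
  have h₀ (x : g₀) : E.proj (s₀ x) = x := congrArg Subtype.val (LinearMap.congr_fun hs₀ x)
  have h₁ (x : g) : E.proj (s x) = x := LinearMap.congr_fun hs x
  -- With `r` a linear retraction onto `g₀`, use the section `s₀` into `h₀` on the `g₀`-part and an
  -- arbitrary section `s` on the rest.
  refine ⟨⟨E.sub.toSubmodule.subtype ∘ₗ s₀ ∘ₗ r +
    s ∘ₗ (LinearMap.id - g₀.toSubmodule.subtype ∘ₗ r), fun x => ?_, fun x hx => ?_⟩⟩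
  · change E.proj (s₀ (r x) + s (x - (r x : g))) = x
    rw [map_add, h₀, h₁, add_sub_cancel]
  · have hx' : r x = ⟨x, hx⟩ := LinearMap.congr_fun hr ⟨x, hx⟩
    change (s₀ (r x) : E.carrier) + s (x - (r x : g)) ∈ E.sub
    rw [hx', sub_self, map_zero, add_zero]
    exact (s₀ _).2

variable {E F}

theorem proj_incl (v : V) : E.proj (E.incl v) = 0 := (E.proj_eq_zero_iff _).mpr ⟨v, rfl⟩

namespace AdaptedSection

theorem exists_eq_add_incl (β : E.AdaptedSection) (z : E.carrier) :
    ∃ v, z = β.toLin (E.proj z) + E.incl v := by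
  have : z - β.toLin (E.proj z) ∈ LinearMap.range E.incl := by
    rw [← E.proj_eq_zero_iff, map_sub, β.proj_apply, sub_self]
  obtain ⟨v, hv⟩ := this
  exact ⟨v, by rw [hv, add_sub_cancel]⟩

/-- In the coordinates `g × V` the bracket depends only on the module structure and the cocycle,
because `V` is commutative; so the cocycle determines the extension. -/
theorem lie_add_incl (β : E.AdaptedSection) (x y : g) (v w : V) :
    ⁅β.toLin x + E.incl v, β.toLin y + E.incl w⁆ =
      β.toLin ⁅x, y⁆ + E.incl (β.cochain x y + ⁅x, w⁆ - ⁅y, v⁆) := by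
  rw [map_sub, map_add, β.incl_cochain, add_lie, lie_add, lie_add, E.lie_incl_incl,
    ← lie_skew (E.incl v), E.lie_incl, E.lie_incl, β.proj_apply, β.proj_apply]
  abel

theorem add_incl_mem_sub (β : E.AdaptedSection) (x : g) (v : V) :
    β.toLin x + E.incl v ∈ E.sub ↔ x ∈ g₀ ∧ v ∈ V₀ := by
  rw [← E.incl_mem_sub_iff]
  constructor
  · intro h
    have hx : x ∈ g₀ := by
      exact E.map_proj_sub.le ⟨_, h, by simp [β.proj_apply, proj_incl]⟩
    exact ⟨hx, (add_mem_cancel_left (β.mem_sub x hx)).mp h⟩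
  · rintro ⟨hx, hv⟩
    exact add_mem (β.mem_sub x hx) hv

/-- The `V`-component of an element with respect to an adapted section. -/
noncomputable def coord (β : E.AdaptedSection) : E.carrier →ₗ[k] V :=
  E.inclEquiv.symm ∘ₗ (LinearMap.id - β.toLin ∘ₗ (E.proj : E.carrier →ₗ[k] g)).codRestrict
    (LinearMap.range E.incl) (fun z => by
      rw [← E.proj_eq_zero_iff]
      simp [β.proj_apply])

theorem coord_add_incl (β : E.AdaptedSection) (x : g) (v : V) :
    β.coord (β.toLin x + E.incl v) = v := by
  apply E.incl_injective
  refine (E.incl_inclEquiv_symm _).trans ?_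
  simp [β.proj_apply, proj_incl]

/-- The linear equivalence of `g × V` with the extension given by an adapted section. -/
noncomputable def prodEquiv (β : E.AdaptedSection) : (g × V) ≃ₗ[k] E.carrier where
  toFun p := β.toLin p.1 + E.incl p.2
  map_add' _ _ := by simp; abel
  map_smul' _ _ := by simp
  invFun z := (E.proj z, β.coord z)
  left_inv p := by simp [β.proj_apply, proj_incl, coord_add_incl]
  right_inv z := by
    obtain ⟨v, hv⟩ := β.exists_eq_add_incl z
    have : β.coord z = v := by rw [hv, coord_add_incl]
    change β.toLin (E.proj z) + E.incl (β.coord z) = z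
    rw [this]
    exact hv.symm

/-- Extensions with adapted sections that have the same cocycle are equivalent. -/
theorem equivalent_of_cochain_eq (β : E.AdaptedSection) (γ : F.AdaptedSection)
    (h : β.cochain = γ.cochain) : Equivalent E F := by
  let f := β.prodEquiv.symm.trans γ.prodEquiv
  have hf (x : g) (v : V) : f (β.toLin x + E.incl v) = γ.toLin x + F.incl v := by
    change γ.prodEquiv (β.prodEquiv.symm (β.prodEquiv (x, v))) = _
    rw [LinearEquiv.symm_apply_apply]
    rfl
  refine ⟨{ f with map_lie' := ?_ }, fun z => ?_, fun v => ?_, fun z => ?_⟩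
  · intro z w
    change f ⁅z, w⁆ = ⁅f z, f w⁆
    obtain ⟨v, hv⟩ := β.exists_eq_add_incl z
    obtain ⟨u, hu⟩ := β.exists_eq_add_incl w
    rw [hv, hu, lie_add_incl, hf, hf, hf, lie_add_incl, h]
  · change f z ∈ F.sub ↔ _
    obtain ⟨v, hv⟩ := β.exists_eq_add_incl z
    rw [hv, hf, add_incl_mem_sub, add_incl_mem_sub]
  · change f (E.incl v) = _
    simpa using hf 0 v
  · change F.proj (f z) = _
    obtain ⟨v, hv⟩ := β.exists_eq_add_incl z
    rw [hv, hf]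
    simp [γ.proj_apply, β.proj_apply, proj_incl]

/-- The adapted section `β + ψ` for a relative cochain `ψ`. -/
def addIncl (β : E.AdaptedSection) (ψ : oneCochain k g V) (hψ : ψ ∈ relOneCochain g₀ V₀) :
    E.AdaptedSection where
  toLin := β.toLin + E.incl ∘ₗ ψ
  proj_apply x := by simp [β.proj_apply, proj_incl]
  mem_sub x hx := (β.add_incl_mem_sub x (ψ x)).mpr ⟨hx, hψ x hx⟩

/-- No term quadratic in `ψ` appears, since `V` is commutative. -/
theorem cochain_addIncl (β : E.AdaptedSection) (ψ : oneCochain k g V)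
    (hψ : ψ ∈ relOneCochain g₀ V₀) :
    (β.addIncl ψ hψ).cochain = β.cochain + d₁₂ k g V ψ := by
  refine Subtype.ext (LinearMap.ext₂ fun x y => E.incl_injective ?_)
  refine ((β.addIncl ψ hψ).incl_cochain x y).trans ?_
  change ⁅β.toLin x + E.incl (ψ x), β.toLin y + E.incl (ψ y)⁆ -
    (β.toLin ⁅x, y⁆ + E.incl (ψ ⁅x, y⁆)) =
      E.incl (β.cochain x y + (⁅x, ψ y⁆ - ⁅y, ψ x⁆ - ψ ⁅x, y⁆))
  rw [lie_add_incl]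
  simp only [map_add, map_sub]
  abel

/-- Two sections differ by a map into `ker proj = V`, and on `g₀` the difference lies in `V ∩ h₀ =
V₀`. -/
theorem exists_eq_addIncl (β γ : E.AdaptedSection) :
    ∃ ψ, ∃ hψ : ψ ∈ relOneCochain g₀ V₀, (γ.addIncl ψ hψ).toLin = β.toLin := by
  have h (x : g) : γ.toLin x + E.incl (γ.coord (β.toLin x)) = β.toLin x := by
    have := γ.prodEquiv.apply_symm_apply (β.toLin x)
    change γ.toLin (E.proj (β.toLin x)) + _ = _ at this
    rwa [β.proj_apply] at this
  refine ⟨γ.coord ∘ₗ β.toLin, fun x hx => ?_, LinearMap.ext h⟩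
  have := β.mem_sub x hx
  rw [← h, add_incl_mem_sub] at this
  exact this.2

theorem cochain_congr {β γ : E.AdaptedSection} (h : β.toLin = γ.toLin) :
    β.cochain = γ.cochain := by
  obtain ⟨_, _, _⟩ := β
  obtain ⟨_, _, _⟩ := γ
  subst h
  rfl

/-- The transport of an adapted section along an equivalence. -/
def map (β : E.AdaptedSection) (f : E.carrier ≃ₗ⁅k⁆ F.carrier) (h₀ : ∀ x, f x ∈ F.sub ↔ x ∈ E.sub)
    (h₂ : ∀ x, F.proj (f x) = E.proj x) : F.AdaptedSection where
  toLin := (f : E.carrier →ₗ[k] F.carrier) ∘ₗ β.toLin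
  proj_apply x := (h₂ _).trans (β.proj_apply x)
  mem_sub x hx := (h₀ _).mpr (β.mem_sub x hx)

theorem cochain_map (β : E.AdaptedSection) (f : E.carrier ≃ₗ⁅k⁆ F.carrier)
    (h₀ : ∀ x, f x ∈ F.sub ↔ x ∈ E.sub) (h₁ : ∀ v, f (E.incl v) = F.incl v)
    (h₂ : ∀ x, F.proj (f x) = E.proj x) : (β.map f h₀ h₂).cochain = β.cochain := by
  refine Subtype.ext (LinearMap.ext₂ fun x y => F.incl_injective ?_)
  refine ((β.map f h₀ h₂).incl_cochain x y).trans ?_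
  change ⁅f (β.toLin x), f (β.toLin y)⁆ - f (β.toLin ⁅x, y⁆) = F.incl (β.cochain x y)
  rw [← h₁, incl_cochain, map_sub, LieEquiv.map_lie]

/-- Two extensions are equivalent if and only if their cocycles are cohomologous. -/
theorem equivalent_iff (β : E.AdaptedSection) (γ : F.AdaptedSection) :
    Equivalent E F ↔
      (Submodule.Quotient.mk β.cocycle : relH2 g₀ V₀) = Submodule.Quotient.mk γ.cocycle := by
  rw [relH2_mk_eq_iff]
  constructor
  · rintro ⟨f, h₀, h₁, h₂⟩
    obtain ⟨ψ, hψ, h⟩ := (β.map f h₀ h₂).exists_eq_addIncl γ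
    refine ⟨ψ, hψ, ?_⟩
    have h' := cochain_congr h
    rw [cochain_addIncl, cochain_map β f h₀ h₁ h₂] at h'
    exact eq_sub_of_add_eq' h'
  · rintro ⟨ψ, hψ, h⟩
    refine β.equivalent_of_cochain_eq (γ.addIncl ψ hψ) ?_
    rw [cochain_addIncl, h]
    exact (add_sub_cancel _ _).symm

end AdaptedSection

/-- The linear equivalence of `g × V` with the Lie algebra defined by a two-cocycle. -/
def prodEquivOfTwoCocycle (c : twoCocycle k g V) :
    (g × V) ≃ₗ[k] LieAlgebra.ofTwoCocycle c where
  __ := LieAlgebra.ofProd c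
  map_add' _ _ := rfl
  map_smul' _ _ := rfl

theorem lie_prodEquivOfTwoCocycle (c : twoCocycle k g V) (x y : g) (v w : V) :
    ⁅prodEquivOfTwoCocycle c (x, v), prodEquivOfTwoCocycle c (y, w)⁆ =
      prodEquivOfTwoCocycle c (⁅x, y⁆, c.1 x y + ⁅x, w⁆ - ⁅y, v⁆) := rfl

/-- The projection to `g` of the Lie algebra defined by a two-cocycle. -/
def projOfTwoCocycle (c : twoCocycle k g V) : LieAlgebra.ofTwoCocycle c →ₗ⁅k⁆ g where
  __ := LinearMap.fst k g V ∘ₗ ((prodEquivOfTwoCocycle c).symm : _ →ₗ[k] g × V)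
  map_lie' := rfl

theorem projOfTwoCocycle_apply (c : twoCocycle k g V) (p : g × V) :
    projOfTwoCocycle c (prodEquivOfTwoCocycle c p) = p.1 := rfl

variable (V₀) in
/-- The subalgebra `g₀ × V₀` of the Lie algebra defined by a relative two-cocycle. -/
def subOfTwoCocycle (c : twoCocycle k g V) (hc : c.1 ∈ relTwoCochain g₀ V₀) :
    LieSubalgebra k (LieAlgebra.ofTwoCocycle c) where
  __ := (g₀.toSubmodule.prod V₀.toSubmodule).map (prodEquivOfTwoCocycle c : g × V →ₗ[k] _)
  lie_mem' := by
    rintro _ _ ⟨⟨x, v⟩, ⟨hx, hv⟩, rfl⟩ ⟨⟨y, w⟩, ⟨hy, hw⟩, rfl⟩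
    exact ⟨_, ⟨g₀.lie_mem hx hy, sub_mem (add_mem (hc x hx y hy)
      (V₀.lie_mem (x := (⟨x, hx⟩ : g₀)) hw)) (V₀.lie_mem (x := (⟨y, hy⟩ : g₀)) hv)⟩, rfl⟩

theorem mem_subOfTwoCocycle (c : twoCocycle k g V) (hc : c.1 ∈ relTwoCochain g₀ V₀) (p : g × V) :
    prodEquivOfTwoCocycle c p ∈ subOfTwoCocycle V₀ c hc ↔ p.1 ∈ g₀ ∧ p.2 ∈ V₀ := by
  constructor
  · rintro ⟨q, hq, h⟩
    rw [← (prodEquivOfTwoCocycle c).injective h]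
    exact hq
  · exact fun h => ⟨p, h, rfl⟩

/-- The extension defined by a relative two-cocycle. -/
def ofRelTwoCocycle (c : twoCocycle k g V) (hc : c.1 ∈ relTwoCochain g₀ V₀) :
    Extension g₀ V₀ where
  carrier := LieAlgebra.ofTwoCocycle c
  sub := subOfTwoCocycle V₀ c hc
  incl := (prodEquivOfTwoCocycle c : g × V →ₗ[k] _) ∘ₗ LinearMap.inr k g V
  proj := projOfTwoCocycle c
  incl_injective := (prodEquivOfTwoCocycle c).injective.comp LinearMap.inr_injective
  lie_incl_incl v w := by
    refine (lie_prodEquivOfTwoCocycle c 0 0 v w).trans ?_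
    simp
  incl_mem_sub_iff v := by
    refine (mem_subOfTwoCocycle c hc (0, v)).trans ?_
    simp
  proj_surjective x := ⟨prodEquivOfTwoCocycle c (x, 0), rfl⟩
  proj_eq_zero_iff z := by
    obtain ⟨⟨x, v⟩, rfl⟩ := (prodEquivOfTwoCocycle c).surjective z
    rw [projOfTwoCocycle_apply]
    constructor
    · rintro rfl
      exact ⟨v, rfl⟩
    · rintro ⟨w, hw⟩
      exact (congrArg Prod.fst ((prodEquivOfTwoCocycle c).injective hw)).symm
  map_proj_sub := by
    ext x
    constructor
    · rintro ⟨_, ⟨p, hp, rfl⟩, rfl⟩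
      exact hp.1
    · intro hx
      exact ⟨_, (mem_subOfTwoCocycle c hc (x, 0)).mpr ⟨hx, zero_mem V₀⟩, rfl⟩
  lie_incl z v := by
    obtain ⟨⟨x, w⟩, rfl⟩ := (prodEquivOfTwoCocycle c).surjective z
    refine (lie_prodEquivOfTwoCocycle c x 0 w v).trans ?_
    simp [projOfTwoCocycle_apply]

/-- The standard adapted section of the extension defined by a relative two-cocycle. -/
def sectionOfRelTwoCocycle (c : twoCocycle k g V) (hc : c.1 ∈ relTwoCochain g₀ V₀) :
    (ofRelTwoCocycle c hc).AdaptedSection where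
  toLin := (prodEquivOfTwoCocycle c : g × V →ₗ[k] LieAlgebra.ofTwoCocycle c) ∘ₗ LinearMap.inl k g V
  proj_apply _ := rfl
  mem_sub x hx := (mem_subOfTwoCocycle c hc (x, 0)).mpr ⟨hx, zero_mem V₀⟩

theorem cochain_sectionOfRelTwoCocycle (c : twoCocycle k g V) (hc : c.1 ∈ relTwoCochain g₀ V₀) :
    (sectionOfRelTwoCocycle c hc).cochain = c.1 := by
  refine Subtype.ext (LinearMap.ext₂ fun x y => (ofRelTwoCocycle c hc).incl_injective ?_)
  refine ((sectionOfRelTwoCocycle c hc).incl_cochain x y).trans ?_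
  change ⁅prodEquivOfTwoCocycle c (x, 0), prodEquivOfTwoCocycle c (y, 0)⁆ -
    prodEquivOfTwoCocycle c (⁅x, y⁆, 0) = prodEquivOfTwoCocycle c (0, c.1 x y)
  rw [lie_prodEquivOfTwoCocycle, ← map_sub]
  simp

/-- Every relative two-cocycle is the cocycle of some extension. -/
theorem exists_cocycle_eq (c : relTwoCocycle g₀ V₀) :
    ∃ (E : Extension g₀ V₀) (β : E.AdaptedSection), β.cocycle = c :=
  ⟨_, _, Subtype.ext (cochain_sectionOfRelTwoCocycle ⟨c.1, c.2.2⟩ c.2.1)⟩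

end Extension

end Extensions

/-! ### The connecting map and the classification -/

section Semisimple

variable {k : Type uk} [Field k] [CharZero k] {g : Type ug} [LieRing g] [LieAlgebra k g]
variable [FiniteDimensional k g] [LieAlgebra.IsSemisimple k g]
variable {V : Type uV} [AddCommGroup V] [Module k V] [FiniteDimensional k V]
variable [LieRingModule g V] [LieModule k g V]
variable {g₀ : LieSubalgebra k g} {V₀ : LieSubmodule k g₀ V}

/-- The connecting map `H¹(g₀, V/V₀) → H²(g, g₀, V, V₀)` is well defined and injective. -/
theorem H1_mk_eq_iff_relH2_mk_eq (φ ψ : oneCochain k g V)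
    (hφ : proj₁ g₀ V₀ φ ∈ oneCocycle k g₀ (V ⧸ V₀))
    (hψ : proj₁ g₀ V₀ ψ ∈ oneCocycle k g₀ (V ⧸ V₀)) :
    (Submodule.Quotient.mk ⟨_, hφ⟩ : H1 k g₀ (V ⧸ V₀)) = Submodule.Quotient.mk ⟨_, hψ⟩ ↔
      (Submodule.Quotient.mk ⟨_, d₁₂_mem_relTwoCocycle g₀ V₀ φ hφ⟩ : relH2 g₀ V₀) =
        Submodule.Quotient.mk ⟨_, d₁₂_mem_relTwoCocycle g₀ V₀ ψ hψ⟩ := by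
  rw [H1_mk_eq_iff, relH2_mk_eq_iff]
  have hd (v : V) : d₁₂ k g V (d₀₁ k g V v) = 0 :=
    LinearMap.mem_ker.mp (range_d₀₁_le k g V ⟨v, rfl⟩)
  constructor
  · rintro ⟨m, hm⟩
    obtain ⟨v, rfl⟩ := LieSubmodule.Quotient.surjective_mk' V₀ m
    -- Subtracting `dv` makes `φ - ψ` a relative cochain without changing its differential.
    refine ⟨φ - ψ - d₀₁ k g V v, ?_, ?_⟩
    · rw [← proj₁_eq_zero_iff, map_sub, map_sub, proj₁_d₀₁, hm, sub_self]
    · rw [map_sub, map_sub, hd, sub_zero]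
  · rintro ⟨χ, hχ, h⟩
    -- Injectivity: `φ - ψ - χ` is a cocycle on all of `g`, hence some `dv`, and `π` kills `χ`.
    obtain ⟨v, hv⟩ := LieAlgebra.IsSemisimple.oneCocycle_eq_lie (φ - ψ - χ) (by
      rw [map_sub, map_sub, h, sub_self])
    refine ⟨LieSubmodule.Quotient.mk' V₀ v, ?_⟩
    have hv' : φ - ψ - χ = d₀₁ k g V v := LinearMap.ext hv
    rw [← proj₁_d₀₁, ← hv', map_sub, map_sub, (proj₁_eq_zero_iff χ).mpr hχ, sub_zero]

/-- The connecting map `H¹(g₀, V/V₀) → H²(g, g₀, V, V₀)` is surjective. -/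
theorem exists_d₁₂_eq (c : relTwoCocycle g₀ V₀) :
    ∃ (φ : oneCochain k g V) (_ : proj₁ g₀ V₀ φ ∈ oneCocycle k g₀ (V ⧸ V₀)),
      d₁₂ k g V φ = c.1 := by
  obtain ⟨φ, hφ⟩ := LieAlgebra.IsSemisimple.twoCocycle_eq_d₁₂ c.1
    ((mem_twoCocycle_iff k g V _).mp c.2.2)
  refine ⟨φ, ?_, hφ⟩
  refine LinearMap.mem_ker.mpr (Subtype.ext (LinearMap.ext₂ fun x y => ?_))
  -- `π(φ)` is a cocycle exactly because `dφ = c` maps `g₀ × g₀` into `V₀`.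
  have h : d₁₂ k g V φ x y ∈ V₀ := hφ ▸ c.2.1 x x.2 y y.2
  exact (LieSubmodule.Quotient.mk_eq_zero (N := V₀)).mpr h

variable (g₀ V₀) in
/-- The classification of the extensions of `(V, V₀)` by `H¹(g₀, V/V₀)`. -/
theorem existsUnique_extensionClass_equiv :
    ∃! Φ : ExtensionClass g₀ V₀ ≃ H1 k g₀ (V ⧸ V₀),
      ∀ (E : Extension g₀ V₀) (β : E.AdaptedSection) (φ : oneCochain k g V)
        (hφ : proj₁ g₀ V₀ φ ∈ oneCocycle k g₀ (V ⧸ V₀)),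
        (Φ (Quotient.mk (Extension.setoid g₀ V₀) E) = Submodule.Quotient.mk ⟨_, hφ⟩) ↔
          (Submodule.Quotient.mk β.cocycle : relH2 g₀ V₀) =
            Submodule.Quotient.mk ⟨_, d₁₂_mem_relTwoCocycle g₀ V₀ φ hφ⟩ := by
  let β (E : Extension g₀ V₀) : E.AdaptedSection := Classical.choice E.nonempty_adaptedSection
  choose φ hφ hd using fun c : relTwoCocycle g₀ V₀ => exists_d₁₂_eq c
  let F (E : Extension g₀ V₀) : H1 k g₀ (V ⧸ V₀) :=
    Submodule.Quotient.mk ⟨_, hφ (β E).cocycle⟩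
  have hmk (c : relTwoCocycle g₀ V₀) :
      (⟨_, d₁₂_mem_relTwoCocycle g₀ V₀ (φ c) (hφ c)⟩ : relTwoCocycle g₀ V₀) = c :=
    Subtype.ext (hd c)
  have hF (E : Extension g₀ V₀) (γ : E.AdaptedSection) (ψ : oneCochain k g V)
      (hψ : proj₁ g₀ V₀ ψ ∈ oneCocycle k g₀ (V ⧸ V₀)) :
      F E = Submodule.Quotient.mk ⟨_, hψ⟩ ↔
        (Submodule.Quotient.mk γ.cocycle : relH2 g₀ V₀) =
          Submodule.Quotient.mk ⟨_, d₁₂_mem_relTwoCocycle g₀ V₀ ψ hψ⟩ := by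
    -- Independence of the section: `equivalent_iff` applied to the reflexive equivalence of `E`
    -- with itself.
    rw [H1_mk_eq_iff_relH2_mk_eq, hmk,
      ((β E).equivalent_iff γ).mp ((Extension.setoid g₀ V₀).iseqv.refl E)]
  have hFF (E E' : Extension g₀ V₀) : F E = F E' ↔ Extension.Equivalent E E' := by
    rw [hF E (β E), hmk, (β E).equivalent_iff (β E')]
  have hex (c : H1 k g₀ (V ⧸ V₀)) : ∃ (ψ : oneCochain k g V)
      (hψ : proj₁ g₀ V₀ ψ ∈ oneCocycle k g₀ (V ⧸ V₀)), c = Submodule.Quotient.mk ⟨_, hψ⟩ := by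
    obtain ⟨⟨c, hc⟩, rfl⟩ := Submodule.Quotient.mk_surjective _ c
    obtain ⟨ψ, rfl⟩ := proj₁_surjective c
    exact ⟨ψ, hc, rfl⟩
  let Φ : ExtensionClass g₀ V₀ → H1 k g₀ (V ⧸ V₀) :=
    Quotient.lift F fun E E' h => (hFF E E').mpr h
  have hΦ : Function.Bijective Φ := by
    constructor
    · rintro ⟨E⟩ ⟨E'⟩ h
      exact Quotient.sound ((hFF E E').mp h)
    · intro c
      obtain ⟨ψ, hψ, rfl⟩ := hex c
      obtain ⟨E, γ, hγ⟩ := Extension.exists_cocycle_eq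
        ⟨_, d₁₂_mem_relTwoCocycle g₀ V₀ ψ hψ⟩
      exact ⟨Quotient.mk _ E, (hF E γ ψ hψ).mpr (by rw [hγ])⟩
  -- Uniqueness: every class is some `[π(ψ)]`, and for a `ψ` representing `F E` the stated property
  -- forces the value at `E`.
  refine ⟨Equiv.ofBijective Φ hΦ, hF, fun Ψ hΨ => Equiv.ext ?_⟩
  rintro ⟨E⟩
  obtain ⟨ψ, hψ, h⟩ := hex (F E)
  exact ((hΨ E (β E) ψ hψ).mpr ((hF E (β E) ψ hψ).mp h)).trans h.symm

end Semisimple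

end LiePair

theorem mainTheorem5 {k : Type*} [Field k] [CharZero k]
    {g : Type*} [LieRing g] [LieAlgebra k g] [FiniteDimensional k g] [LieAlgebra.IsSemisimple k g]
    (g₀ : LieSubalgebra k g)
    {V : Type*} [AddCommGroup V] [Module k V] [FiniteDimensional k V]
    [LieRingModule g V] [LieModule k g V]
    (V₀ : LieSubmodule k g₀ V) :
    ∃! Φ : LiePair.ExtensionClass g₀ V₀ ≃ LiePair.H1 k g₀ (V ⧸ V₀),
      ∀ (E : LiePair.Extension g₀ V₀) (β : E.AdaptedSection)
        (φ : LieModule.Cohomology.oneCochain k g V)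
        (hφ : LiePair.proj₁ g₀ V₀ φ ∈ LiePair.oneCocycle k g₀ (V ⧸ V₀)),
        (Φ (Quotient.mk (LiePair.Extension.setoid g₀ V₀) E) =
            Submodule.Quotient.mk ⟨LiePair.proj₁ g₀ V₀ φ, hφ⟩) ↔
          (Submodule.Quotient.mk β.cocycle : LiePair.relH2 g₀ V₀) =
            Submodule.Quotient.mk ⟨LieModule.Cohomology.d₁₂ k g V φ,
              LiePair.d₁₂_mem_relTwoCocycle g₀ V₀ φ hφ⟩ :=
  LiePair.existsUnique_extensionClass_equiv g₀ V₀
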